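/- Let $V$ be a finite-dimensional vector space over a field $\mathbb K$, and let $\mathcal A$ be a central hyperplane arrangement in $V$, i.e. a finite set of linear subspaces of $V$ of codimension one. For a subspace $X\subseteq V$ put $r(X)=\dim V-\dim X$ and $\mathcal A_X=\{H\in\mathcal A : X\subseteq H\}$. Let $L(\mathcal A)$ be the set of all intersections of hyperplanes in $\mathcal A$ (the empty intersection being $V$), ordered by reverse inclusion. It is a lattice with least element $V$, greatest element $T=\bigcap_{H\in\mathcal A}H$, join $X\vee Y=X\cap Y$, and meet $X\wedge Y$ equal to the intersection of all $Z\in L(\mathcal A)$ with $X\cup Y\subseteq Z$. Put $r=r(T)$. An element $X\in L(\mathcal A)$ is modular if $r(X)+r(Y)=r(X\vee Y)+r(X\wedge Y)$ for all $Y\in L(\mathcal A)$, and a chain in $L(\mathcal A)$ is modular if all its elements are. A set partition $\pi=\{\pi_1,\dots,\pi_\ell\}$ of $\mathcal A$ (into nonempty, pairwise disjoint parts with union $\mathcal A$) is nice if the following two conditions hold: (a) for every $p\ge 0$ and all $H_1,\dots,H_p\in\mathcal A$ lying in pairwise different parts of $\pi$, one has $r(H_1\cap\dots\cap H_p)=p$;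 (b) for every $X\in L(\mathcal A)\setminus\{V\}$ there is an $i$ with $|\pi_i\cap\mathcal A_X|=1$. **Theorem 1.4.** Let $\mathcal C\colon V=X_0<X_1<\dots<X_r=T$ be a maximal chain of $L(\mathcal A)$, and let $\pi_i=\mathcal A_{X_i}\setminus\mathcal A_{X_{i-1}}$ for $i=1,\dots,r$. Then $\pi=\{\pi_1,\dots,\pi_r\}$ is a set partition of $\mathcal A$, and $\pi$ is a nice partition if and only if $\mathcal C$ is a modular chain. -/

import Mathlib

/-- A central hyperplane arrangement in a vector space `V`: a finite set of linear hyperplanes,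
that is, of linear subspaces of codimension one. -/
structure HyperplaneArrangement (K V : Type*) [Field K] [AddCommGroup V] [Module K V] where
  /-- the hyperplanes of the arrangement -/
  hyperplanes : Set (Submodule K V)
  finite : hyperplanes.Finite
  isHyperplane : ∀ H ∈ hyperplanes, Module.finrank K H + 1 = Module.finrank K V

namespace HyperplaneArrangement

section

variable {K V : Type*} [Field K] [AddCommGroup V] [Module K V]

/-- The intersection poset `L(A)`: the subspaces that are intersections of hyperplanes of `A`
(the empty intersection is `V`). Its order, reverse inclusion, is defined below. -/
structure IntersectionLattice (A : HyperplaneArrangement K V) where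
  /-- the underlying subspace of an element of `L(A)` -/
  carrier : Submodule K V
  isIntersection : ∃ S : Set (Submodule K V), S ⊆ A.hyperplanes ∧ carrier = sInf S

/-- The localization `A_X`, as a set of hyperplanes: the hyperplanes of `A` that contain `X`. -/
def localization (A : HyperplaneArrangement K V) (X : Submodule K V) : Set (Submodule K V) :=
  {H | H ∈ A.hyperplanes ∧ X ≤ H}

namespace IntersectionLattice

variable {A : HyperplaneArrangement K V}

theorem carrier_injective :
    Function.Injective (carrier : A.IntersectionLattice → Submodule K V) := by
  rintro ⟨X, hX⟩ ⟨Y, hY⟩ h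
  cases h
  rfl

/-- The order of `L(A)` is reverse inclusion. -/
instance : PartialOrder A.IntersectionLattice where
  le X Y := Y.carrier ≤ X.carrier
  le_refl X := le_refl X.carrier
  le_trans _ _ _ h₁ h₂ := le_trans (α := Submodule K V) h₂ h₁
  le_antisymm _ _ h₁ h₂ := carrier_injective (le_antisymm (α := Submodule K V) h₂ h₁)

/-- The join of `X` and `Y` is `X ∩ Y`. -/
def join (X Y : A.IntersectionLattice) : A.IntersectionLattice where
  carrier := X.carrier ⊓ Y.carrier
  isIntersection := by
    obtain ⟨S, hS, hX⟩ := X.isIntersection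
    obtain ⟨S', hS', hY⟩ := Y.isIntersection
    exact ⟨S ∪ S', Set.union_subset hS hS', by rw [hX, hY, sInf_union]⟩

/-- The meet of `X` and `Y` is the intersection of all elements of `L(A)` that contain both. -/
def meet (X Y : A.IntersectionLattice) : A.IntersectionLattice where
  carrier := ⨅ Z : {Z : A.IntersectionLattice // X.carrier ≤ Z.carrier ∧ Y.carrier ≤ Z.carrier},
    Z.1.carrier
  isIntersection := by
    refine ⟨A.localization (⨅ Z : {Z : A.IntersectionLattice //
      X.carrier ≤ Z.carrier ∧ Y.carrier ≤ Z.carrier}, Z.1.carrier), fun H hH => hH.1, ?_⟩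
    refine le_antisymm (le_sInf fun H hH => hH.2) (le_iInf fun Z => ?_)
    obtain ⟨S, hS, hZ⟩ := Z.1.isIntersection
    rw [hZ]
    refine sInf_le_sInf fun H hH => ⟨hS hH, ?_⟩
    refine (iInf_le _ Z).trans ?_
    rw [hZ]
    exact sInf_le hH

instance : Lattice A.IntersectionLattice where
  sup := join
  inf := meet
  le_sup_left _ _ := inf_le_left (α := Submodule K V)
  le_sup_right _ _ := inf_le_right (α := Submodule K V)
  sup_le _ _ _ h₁ h₂ := le_inf (α := Submodule K V) h₁ h₂
  inf_le_left X _ := le_iInf (a := X.carrier) fun Z => Z.2.1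
  inf_le_right _ Y := le_iInf (a := Y.carrier) fun Z => Z.2.2
  le_inf Z _ _ h₁ h₂ := iInf_le (fun W : {W : A.IntersectionLattice // _} ↦ W.1.carrier)
    ⟨Z, h₁, h₂⟩

/-- The least element of `L(A)` is `V`; the greatest one is the intersection `T` of all
hyperplanes of `A`. -/
instance : BoundedOrder A.IntersectionLattice where
  bot := ⟨⊤, ∅, Set.empty_subset _, sInf_empty.symm⟩
  bot_le _ := le_top (α := Submodule K V)
  top := ⟨sInf A.hyperplanes, A.hyperplanes, subset_rfl, rfl⟩
  le_top X := by
    obtain ⟨S, hS, hX⟩ := X.isIntersection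
    change sInf A.hyperplanes ≤ X.carrier
    rw [hX]
    exact sInf_le_sInf hS

end IntersectionLattice

/-- The rank `r(X) = dim V - dim X` of a subspace `X` of `V`. -/
noncomputable def subspaceRank (X : Submodule K V) : ℕ :=
  Module.finrank K V - Module.finrank K X

/-- The rank of the arrangement: the rank of the greatest element `T` of `L(A)`. -/
noncomputable def rank (A : HyperplaneArrangement K V) : ℕ :=
  subspaceRank (⊤ : A.IntersectionLattice).carrier

/-- `X` is a modular element of `L(A)`. -/
def IsModular {A : HyperplaneArrangement K V} (X : A.IntersectionLattice) : Prop :=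
  ∀ Y : A.IntersectionLattice, subspaceRank X.carrier + subspaceRank Y.carrier =
    subspaceRank (X ⊔ Y).carrier + subspaceRank (X ⊓ Y).carrier

/-- `V = X₀ < X₁ < ⋯ < X_m = T` is a maximal chain of `L(A)`. -/
structure IsMaximalChain {A : HyperplaneArrangement K V} {m : ℕ}
    (X : Fin (m + 1) → A.IntersectionLattice) : Prop where
  strictMono : StrictMono X
  first : X 0 = ⊥
  last : X (Fin.last m) = ⊤
  isMaxChain : IsMaxChain (· ≤ ·) (Set.range X)

/-- The family `π₁, …, π_ℓ` is a set partition of the set of hyperplanes of `A`. -/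
structure IsSetPartition (A : HyperplaneArrangement K V) {l : ℕ}
    (π : Fin l → Set (Submodule K V)) : Prop where
  nonempty : ∀ i, (π i).Nonempty
  iUnion_eq : ⋃ i, π i = A.hyperplanes
  disjoint : ∀ i j, i ≠ j → Disjoint (π i) (π j)

/-- `S = (H₁, …, H_p)` is a `p`-section of `π`: a tuple of hyperplanes of `A` whose entries lie in
pairwise different parts of `π`. -/
def IsSection (A : HyperplaneArrangement K V) {l : ℕ} (π : Fin l → Set (Submodule K V))
    {p : ℕ} (S : Fin p → Submodule K V) : Prop :=
  (∀ a, S a ∈ A.hyperplanes) ∧ ∀ a b, a ≠ b → ∀ i, ¬(S a ∈ π i ∧ S b ∈ π i)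

/-- All sections of `π` are independent: the intersection of a `p`-section has rank `p`. -/
def IsIndependentPartition (A : HyperplaneArrangement K V) {l : ℕ}
    (π : Fin l → Set (Submodule K V)) : Prop :=
  ∀ (p : ℕ) (S : Fin p → Submodule K V), A.IsSection π S → subspaceRank (⨅ a, S a) = p

/-- `π` is a nice partition of `A`. -/
structure IsNicePartition (A : HyperplaneArrangement K V) {l : ℕ}
    (π : Fin l → Set (Submodule K V)) : Prop where
  isSetPartition : A.IsSetPartition π
  independent : A.IsIndependentPartition π
  exists_singleton : ∀ X : A.IntersectionLattice, X ≠ ⊥ →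
    ∃ i, (π i ∩ A.localization X.carrier).ncard = 1

/-- The parts `π_i = A_{X_i} \ A_{X_{i-1}}`, `i = 1, …, m`, of a chain `X₀, …, X_m` in `L(A)`
(numbered from `0` to `m - 1`). -/
def chainPartition {A : HyperplaneArrangement K V} {m : ℕ}
    (X : Fin (m + 1) → A.IntersectionLattice) (i : Fin m) : Set (Submodule K V) :=
  A.localization (X i.succ).carrier \ A.localization (X i.castSucc).carrier

end

end HyperplaneArrangement

namespace HyperplaneArrangement

variable {K V : Type*} [Field K] [AddCommGroup V] [Module K V]

/-! Write + for the sum of subspaces. The meet X ∧ Y always contains X + Y, and the dimension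
formula makes X modular exactly when X ∧ Y = X + Y for all Y. Maximality of the chain gives X_{i-1}
∩ H = X_i for H ∈ π_i, and independence of sections is then automatic, so only the singleton
condition is at stake.

If the chain is modular and π_i is the first part meeting A_Y, then X_{i-1} ∧ Y = V, hence X_{i-1} +
Y = V. For H, H' ∈ π_i ∩ A_Y the modular law gives H = Y + (X_{i-1} ∩ H) = Y + X_i ⊆ H'.

Conversely, the singleton condition at H ∩ H' yields `exists_mem_localization_castSucc`, and
modularity descends from T along the chain. -/

/-- A hyperplane of `A`, as an element of `L(A)`. -/
def IntersectionLattice.ofHyperplane {A : HyperplaneArrangement K V} {H : Submodule K V}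
    (hH : H ∈ A.hyperplanes) : A.IntersectionLattice where
  carrier := H
  isIntersection := ⟨{H}, Set.singleton_subset_iff.2 hH, sInf_singleton.symm⟩

theorem localization_subset (A : HyperplaneArrangement K V) (X : Submodule K V) :
    A.localization X ⊆ A.hyperplanes := fun _ h => h.1

theorem localization_antitone (A : HyperplaneArrangement K V) : Antitone A.localization :=
  fun _ _ h _ hH => ⟨hH.1, h.trans hH.2⟩

namespace IntersectionLattice

variable {A : HyperplaneArrangement K V}

theorem carrier_eq_sInf_localization (X : A.IntersectionLattice) :
    X.carrier = sInf (A.localization X.carrier) := by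
  refine le_antisymm (le_sInf fun H hH => hH.2) ?_
  obtain ⟨S, hS, h⟩ := X.isIntersection
  conv_rhs => rw [h]
  exact sInf_le_sInf fun H hH => ⟨hS hH, h ▸ sInf_le hH⟩

theorem sup_carrier (X Y : A.IntersectionLattice) :
    (X ⊔ Y).carrier = X.carrier ⊓ Y.carrier := rfl

theorem le_inf_carrier_left (X Y : A.IntersectionLattice) :
    X.carrier ≤ (X ⊓ Y).carrier := (inf_le_left : X ⊓ Y ≤ X)

theorem le_inf_carrier_right (X Y : A.IntersectionLattice) :
    Y.carrier ≤ (X ⊓ Y).carrier := (inf_le_right : X ⊓ Y ≤ Y)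

/-- A hyperplane is itself an element of L(A), so it lies below X ∧ Y in the lattice order as soon
as it lies below X and Y. -/
theorem mem_localization_inf {X Y : A.IntersectionLattice} {H : Submodule K V} :
    H ∈ A.localization (X ⊓ Y).carrier ↔
      H ∈ A.localization X.carrier ∧ H ∈ A.localization Y.carrier := by
  constructor
  · exact fun h => ⟨⟨h.1, (le_inf_carrier_left X Y).trans h.2⟩,
      ⟨h.1, (le_inf_carrier_right X Y).trans h.2⟩⟩
  · rintro ⟨hX, hY⟩
    exact ⟨hX.1, (le_inf hX.2 hY.2 : ofHyperplane hX.1 ≤ X ⊓ Y)⟩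

theorem localization_nonempty {X : A.IntersectionLattice} (hX : X ≠ ⊥) :
    (A.localization X.carrier).Nonempty := by
  by_contra h
  refine hX (carrier_injective ?_)
  rw [carrier_eq_sInf_localization X, Set.not_nonempty_iff_eq_empty.1 h, sInf_empty]
  rfl

end IntersectionLattice

section Chain

variable {A : HyperplaneArrangement K V} {m : ℕ} {X : Fin (m + 1) → A.IntersectionLattice}

theorem IsMaximalChain.carrier_succ_le (hX : IsMaximalChain X) (i : Fin m) :
    (X i.succ).carrier ≤ (X i.castSucc).carrier :=
  hX.strictMono.monotone i.castSucc_lt_succ.le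

theorem IsMaximalChain.localization_monotone (hX : IsMaximalChain X) :
    Monotone fun i => A.localization (X i).carrier :=
  fun _ _ h => A.localization_antitone (hX.strictMono.monotone h)

theorem IsMaximalChain.localization_last (hX : IsMaximalChain X) :
    A.localization (X (Fin.last m)).carrier = A.hyperplanes := by
  refine (A.localization_subset _).antisymm fun H hH => ⟨hH, ?_⟩
  rw [hX.last]
  exact sInf_le hH

/-- In a maximal chain, `X_{i-1} ∩ H = X_i` for every `H ∈ π_i`. -/
theorem IsMaximalChain.inf_le_carrier_succ (hX : IsMaximalChain X) {i : Fin m}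
    {H : Submodule K V} (hH : H ∈ chainPartition X i) :
    (X i.castSucc).carrier ⊓ H ≤ (X i.succ).carrier := by
  let Z := X i.castSucc ⊔ IntersectionLattice.ofHyperplane hH.1.1
  have hlt : X i.castSucc < Z := by
    refine lt_of_le_of_ne le_sup_left fun h => hH.2 ⟨hH.1.1, ?_⟩
    rw [h]
    exact inf_le_right
  have hle : Z ≤ X i.succ := sup_le (hX.carrier_succ_le i) hH.1.2
  -- Z lies strictly above X_{i-1} and weakly below X_i, so it is comparable with the whole chain
  -- and belongs to it by maximality.
  have hZ : Z ∈ Set.range X := by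
    have hc : IsChain (· ≤ ·) (insert Z (Set.range X)) := by
      refine hX.isMaxChain.1.insert ?_
      rintro _ ⟨k, rfl⟩ -
      rcases le_or_gt k i.castSucc with hk | hk
      · exact Or.inr ((hX.strictMono.monotone hk).trans hlt.le)
      · exact Or.inl (hle.trans (hX.strictMono.monotone (Fin.castSucc_lt_iff_succ_le.1 hk)))
    rw [hX.isMaxChain.2 hc (Set.subset_insert _ _)]
    exact Set.mem_insert _ _
  obtain ⟨k, hk⟩ := hZ
  have hik : i.castSucc < k := hX.strictMono.lt_iff_lt.1 (hk ▸ hlt)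
  have h : X i.succ ≤ Z := hk ▸ hX.strictMono.monotone (Fin.castSucc_lt_iff_succ_le.1 hik)
  exact h

end Chain

section FiniteDimensional

variable [FiniteDimensional K V] {A : HyperplaneArrangement K V}

theorem isCoatom_of_mem_hyperplanes {H : Submodule K V} (hH : H ∈ A.hyperplanes) :
    IsCoatom H := by
  have h := A.isHyperplane H hH
  refine ⟨fun hT => ?_, fun W hW => ?_⟩
  · subst hT
    rw [finrank_top] at h
    omega
  · have h₁ := Submodule.finrank_lt_finrank_of_lt hW
    have h₂ := Submodule.finrank_le W
    exact Submodule.eq_top_of_finrank_eq (by omega)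

/-- `X` is modular if and only if `X ∧ Y = X + Y` for all `Y`. -/
theorem isModular_iff_inf_carrier_le {X : A.IntersectionLattice} :
    IsModular X ↔ ∀ Y : A.IntersectionLattice, (X ⊓ Y).carrier ≤ X.carrier ⊔ Y.carrier := by
  refine forall_congr' fun Y => ?_
  have hle : X.carrier ⊔ Y.carrier ≤ (X ⊓ Y).carrier :=
    sup_le (X.le_inf_carrier_left Y) (X.le_inf_carrier_right Y)
  have h := Submodule.finrank_sup_add_finrank_inf_eq X.carrier Y.carrier
  have hX := Submodule.finrank_le X.carrier
  have hY := Submodule.finrank_le Y.carrier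
  have hs := Submodule.finrank_le (X.carrier ⊓ Y.carrier)
  have hi := Submodule.finrank_le (X ⊓ Y).carrier
  rw [IntersectionLattice.sup_carrier]
  simp only [subspaceRank]
  constructor
  · intro hm
    exact (Submodule.eq_of_le_of_finrank_eq hle (by omega)).ge
  · intro hm
    rw [← le_antisymm hle hm]
    rw [← le_antisymm hle hm] at hi
    omega

variable {m : ℕ} {X : Fin (m + 1) → A.IntersectionLattice}

theorem IsMaximalChain.localization_zero (hX : IsMaximalChain X) :
    A.localization (X 0).carrier = ∅ := by
  refine Set.eq_empty_iff_forall_notMem.2 fun H hH => (isCoatom_of_mem_hyperplanes hH.1).1 ?_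
  have h := hH.2
  rw [hX.first] at h
  exact top_le_iff.1 h

/-- A set `S` that contains a hyperplane of `A` meets some part `π_i` but not `A_{X_{i-1}}`. -/
theorem IsMaximalChain.exists_first (hX : IsMaximalChain X) {S : Set (Submodule K V)}
    (hS : (A.hyperplanes ∩ S).Nonempty) :
    ∃ i : Fin m, (chainPartition X i ∩ S).Nonempty ∧
      A.localization (X i.castSucc).carrier ∩ S = ∅ := by
  by_contra! hcon
  have key : ∀ i, A.localization (X i).carrier ∩ S = ∅ := by
    intro i
    induction i using Fin.induction with
    | zero => rw [hX.localization_zero, Set.empty_inter]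
    | succ i ih =>
      refine Set.eq_empty_iff_forall_notMem.2 fun H hH => ?_
      refine (hcon i ⟨H, ⟨hH.1, fun h => ?_⟩, hH.2⟩).ne_empty ih
      exact (Set.eq_empty_iff_forall_notMem.1 ih H) ⟨h, hH.2⟩
  exact hS.ne_empty (hX.localization_last ▸ key (Fin.last m))

theorem IsMaximalChain.isSetPartition (hX : IsMaximalChain X) :
    A.IsSetPartition (chainPartition X) where
  nonempty i := by
    by_contra h
    have hsub := Set.sdiff_eq_empty.1 (Set.not_nonempty_iff_eq_empty.1 h)
    refine (hX.strictMono i.castSucc_lt_succ).not_ge ?_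
    change (X i.castSucc).carrier ≤ (X i.succ).carrier
    rw [(X i.castSucc).carrier_eq_sInf_localization, (X i.succ).carrier_eq_sInf_localization]
    exact sInf_le_sInf hsub
  iUnion_eq := by
    refine (Set.iUnion_subset fun i H hH => hH.1.1).antisymm fun H hH => ?_
    obtain ⟨i, ⟨H', hH', rfl⟩, -⟩ := hX.exists_first (S := {H}) ⟨H, hH, rfl⟩
    exact Set.mem_iUnion.2 ⟨i, hH'⟩
  disjoint := by
    have key : ∀ i j : Fin m, i < j → Disjoint (chainPartition X i) (chainPartition X j) :=
      fun i j hij => Set.disjoint_left.2 fun H hi hj =>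
        hj.2 (hX.localization_monotone (Fin.succ_le_castSucc_iff.2 hij) hi.1)
    intro i j hij
    rcases hij.lt_or_gt with h | h
    · exact key i j h
    · exact (key j i h).symm

/-- Hyperplanes in pairwise different parts `π_i` are always independent. -/
theorem IsMaximalChain.isIndependentPartition (hX : IsMaximalChain X) :
    A.IsIndependentPartition (chainPartition X) := by
  intro p S hS
  have hidx : ∀ a, ∃ i, S a ∈ chainPartition X i := fun a =>
    Set.mem_iUnion.1 (hX.isSetPartition.iUnion_eq ▸ hS.1 a)
  choose f hf using hidx
  have hinj : ∀ a b, a ≠ b → f a ≠ f b := fun a b hab h => hS.2 a b hab (f a) ⟨hf a, h ▸ hf b⟩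
  have key : ∀ s : Finset (Fin p),
      Module.finrank K (⨅ a ∈ s, S a : Submodule K V) + s.card = Module.finrank K V := by
    intro s
    -- Hyperplanes are added by increasing part index: those already present contain X_{f(a)-1},
    -- while `S a` does not, so each one lowers the dimension by one.
    induction s using Finset.induction_on_max_value f with
    | empty => rw [← Finset.inf_eq_iInf, Finset.inf_empty, finrank_top, Finset.card_empty, Nat.add_zero]
    | insert a s ha hmax ih =>
      set Z : Submodule K V := ⨅ b ∈ s, S b with hZ
      have hle : (X (f a).castSucc).carrier ≤ Z := by
        refine le_iInf₂ fun b hb => ?_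
        have hlt : f b < f a := lt_of_le_of_ne (hmax b hb) (hinj b a fun h => ha (h ▸ hb))
        exact (hX.localization_monotone (Fin.succ_le_castSucc_iff.2 hlt) (hf b).1).2
      have hnot : ¬ Z ≤ S a := fun h => (hf a).2 ⟨hS.1 a, hle.trans h⟩
      have hsup : S a ⊔ Z = ⊤ :=
        (isCoatom_of_mem_hyperplanes (hS.1 a)).2 _ (left_lt_sup.2 hnot)
      have hdim := Submodule.finrank_sup_add_finrank_inf_eq (S a) Z
      have hHdim := A.isHyperplane _ (hS.1 a)
      rw [hsup, finrank_top] at hdim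
      rw [Finset.iInf_insert, ← hZ, Finset.card_insert_of_notMem ha]
      omega
  have h := key Finset.univ
  rw [show (⨅ a ∈ Finset.univ, S a) = ⨅ a, S a by simp, Finset.card_fin] at h
  rw [subspaceRank]
  omega

/-- If the chain is modular, then every `Y ≠ V` singles out a hyperplane in some part: the first
part that contains a hyperplane containing `Y`. -/
theorem IsMaximalChain.exists_ncard_eq_one (hX : IsMaximalChain X) (hmod : ∀ i, IsModular (X i))
    {Y : A.IntersectionLattice} (hY : Y ≠ ⊥) :
    ∃ i, (chainPartition X i ∩ A.localization Y.carrier).ncard = 1 := by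
  obtain ⟨H₀, hH₀⟩ := IntersectionLattice.localization_nonempty hY
  obtain ⟨i, ⟨H, hH, hHY⟩, hi⟩ := hX.exists_first (S := A.localization Y.carrier)
    ⟨H₀, hH₀.1, hH₀⟩
  refine ⟨i, Set.ncard_eq_one.2 ⟨H, ?_⟩⟩
  -- No hyperplane of A contains X_{i-1} ∧ Y, so this meet is the empty intersection V.
  have htop : (X i.castSucc).carrier ⊔ Y.carrier = ⊤ := by
    refine top_le_iff.1 (le_trans ?_ (isModular_iff_inf_carrier_le.1 (hmod i.castSucc) Y))
    rw [IntersectionLattice.carrier_eq_sInf_localization]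
    refine le_sInf fun W hW => ?_
    exact absurd (IntersectionLattice.mem_localization_inf.1 hW)
      (Set.eq_empty_iff_forall_notMem.1 hi W)
  refine Set.eq_singleton_iff_unique_mem.2 ⟨⟨hH, hHY⟩, ?_⟩
  rintro H' ⟨hH', hHY'⟩
  have hle : H ≤ H' := by
    calc H = (Y.carrier ⊔ (X i.castSucc).carrier) ⊓ H := by rw [sup_comm, htop, top_inf_eq]
      _ = Y.carrier ⊔ (X i.castSucc).carrier ⊓ H := sup_inf_assoc_of_le _ hHY.2
      _ ≤ H' := sup_le hHY'.2 ((hX.inf_le_carrier_succ hH).trans hH'.1.2)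
  exact ((isCoatom_of_mem_hyperplanes hH.1.1).le_iff_eq
    (isCoatom_of_mem_hyperplanes hH'.1.1).1).1 hle

/-- For a nice chain partition, two hyperplanes `H ≠ H'` in the same part `π_i` admit
`W ∈ A_{X_{i-1}}` with `W ∩ H = H ∩ H'`. -/
theorem IsMaximalChain.exists_mem_localization_castSucc (hX : IsMaximalChain X)
    (hnice : A.IsNicePartition (chainPartition X)) {i : Fin m} {H H' : Submodule K V}
    (hH : H ∈ chainPartition X i) (hH' : H' ∈ chainPartition X i) (hne : H ≠ H') :
    ∃ W ∈ A.localization (X i.castSucc).carrier, H ⊓ H' ≤ W ∧ W ⊓ H ≤ H' := by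
  let Y := IntersectionLattice.ofHyperplane hH.1.1 ⊔ IntersectionLattice.ofHyperplane hH'.1.1
  have hYc : Y.carrier = H ⊓ H' := rfl
  have hcH := isCoatom_of_mem_hyperplanes hH.1.1
  have hcH' := isCoatom_of_mem_hyperplanes hH'.1.1
  have hY : Y ≠ ⊥ := fun h =>
    hcH.1 (top_le_iff.1 ((congrArg IntersectionLattice.carrier h).ge.trans inf_le_left))
  obtain ⟨j, hj⟩ := hnice.exists_singleton Y hY
  obtain ⟨W, hW⟩ := Set.ncard_eq_one.1 hj
  have hWmem : W ∈ chainPartition X j ∩ A.localization Y.carrier := hW ▸ Set.mem_singleton W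
  -- j = i is impossible because π_i contains both H and H'; j > i because every hyperplane
  -- containing H ∩ H' contains X_i.
  have hji : j < i := by
    rcases lt_trichotomy j i with h | h | h
    · exact h
    · subst h
      have h₁ : H ∈ ({W} : Set _) := hW ▸ ⟨hH, hH.1.1, inf_le_left⟩
      have h₂ : H' ∈ ({W} : Set _) := hW ▸ ⟨hH', hH'.1.1, inf_le_right⟩
      exact absurd (h₁.trans h₂.symm) hne
    · have hWi : W ∈ A.localization (X i.succ).carrier :=
        ⟨hWmem.2.1, (le_inf hH.1.2 hH'.1.2).trans hWmem.2.2⟩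
      exact absurd (hX.localization_monotone (Fin.succ_le_castSucc_iff.2 h) hWi) hWmem.1.2
  have hWloc : W ∈ A.localization (X i.castSucc).carrier :=
    hX.localization_monotone (Fin.succ_le_castSucc_iff.2 hji) hWmem.1.1
  refine ⟨W, hWloc, hWmem.2.2, ?_⟩
  have hcW := isCoatom_of_mem_hyperplanes hWloc.1
  have hWH : W ⊓ H < H := by
    refine inf_le_right.lt_of_ne fun h => hH.2 ?_
    have hHW : H ≤ W := inf_eq_right.1 h
    rwa [(hcH.le_iff_eq hcW.1).1 hHW] at hWloc
  have hsup : H ⊔ H' = ⊤ := hcH.2 _ (left_lt_sup.2 fun h => hne ((hcH'.le_iff_eq hcH.1).1 h))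
  have hcov : H ⊓ H' ⋖ H := inf_covBy_of_covBy_sup_right (hsup ▸ hcH'.covBy_top)
  have heq : W ⊓ H = H ⊓ H' :=
    (hcov.eq_or_eq (le_inf hWmem.2.2 inf_le_left) inf_le_right).resolve_right hWH.ne
  exact heq.le.trans inf_le_right

/-- Downward induction from T, which is trivially modular. -/
theorem IsMaximalChain.isModular_of_isNicePartition (hX : IsMaximalChain X)
    (hnice : A.IsNicePartition (chainPartition X)) (i : Fin (m + 1)) : IsModular (X i) := by
  refine isModular_iff_inf_carrier_le.2 fun Y => ?_
  induction i using Fin.reverseInduction with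
  | last =>
    rw [hX.last, top_inf_eq]
    exact le_sup_right
  | cast i ih =>
    -- By modularity of X_i and X_i ⊆ X_{i-1}, it suffices that X_{i-1} ∧ Y ⊆ X_{i-1} + (X_i ∧ Y).
    refine le_trans ?_ (sup_le le_sup_left
      (ih.trans (sup_le_sup_right (hX.carrier_succ_le i) Y.carrier)))
    rcases (chainPartition X i ∩ A.localization Y.carrier).eq_empty_or_nonempty with
      hemp | ⟨H, hH, hHY⟩
    -- Here X_i ∧ Y and X_{i-1} ∧ Y lie in the same hyperplanes, so they coincide.
    · refine le_trans ?_ le_sup_right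
      rw [(X i.succ ⊓ Y).carrier_eq_sInf_localization]
      refine le_sInf fun W hW => ?_
      obtain ⟨hWX, hWY⟩ := IntersectionLattice.mem_localization_inf.1 hW
      have hWX' : W ∈ A.localization (X i.castSucc).carrier := by
        by_contra h
        exact Set.eq_empty_iff_forall_notMem.1 hemp W ⟨⟨hWX, h⟩, hWY⟩
      exact (IntersectionLattice.mem_localization_inf.2 ⟨hWX', hWY⟩).2
    -- A hyperplane H' ≠ H of π_i ∩ A_Y contains W ∩ H for some W ∈ A_{X_{i-1}} ∩ A_Y, so it imposes
    -- nothing beyond H. The modular law with X_{i-1} + H = V then finishes.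
    · have hmeet : H ⊓ (X i.castSucc ⊓ Y).carrier ≤ (X i.succ ⊓ Y).carrier := by
        rw [(X i.succ ⊓ Y).carrier_eq_sInf_localization]
        refine le_sInf fun H' hH' => ?_
        obtain ⟨hHX', hHY'⟩ := IntersectionLattice.mem_localization_inf.1 hH'
        by_cases hc : H' ∈ A.localization (X i.castSucc).carrier
        · exact inf_le_right.trans (IntersectionLattice.mem_localization_inf.2 ⟨hc, hHY'⟩).2
        rcases eq_or_ne H H' with rfl | hne
        · exact inf_le_left
        obtain ⟨W, hW, hle, hle'⟩ :=
          hX.exists_mem_localization_castSucc hnice hH ⟨hHX', hc⟩ hne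
        have hWY : W ∈ A.localization Y.carrier := ⟨hW.1, (le_inf hHY.2 hHY'.2).trans hle⟩
        exact (le_inf (inf_le_right.trans
          (IntersectionLattice.mem_localization_inf.2 ⟨hW, hWY⟩).2) inf_le_left).trans hle'
      have hsup : (X i.castSucc).carrier ⊔ H = ⊤ :=
        (isCoatom_of_mem_hyperplanes hH.1.1).2 _ (right_lt_sup.2 fun h => hH.2 ⟨hH.1.1, h⟩)
      calc (X i.castSucc ⊓ Y).carrier
          = ((X i.castSucc).carrier ⊔ H) ⊓ (X i.castSucc ⊓ Y).carrier := by
            rw [hsup, top_inf_eq]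
        _ = (X i.castSucc).carrier ⊔ H ⊓ (X i.castSucc ⊓ Y).carrier :=
            sup_inf_assoc_of_le _ (IntersectionLattice.le_inf_carrier_left _ _)
        _ ≤ _ := sup_le_sup_left hmeet _

end FiniteDimensional

end HyperplaneArrangement

theorem theorem1p4 {K V : Type*} [Field K] [AddCommGroup V] [Module K V] [FiniteDimensional K V]
    (A : HyperplaneArrangement K V)
    (X : Fin (A.rank + 1) → A.IntersectionLattice)
    (hX : HyperplaneArrangement.IsMaximalChain X) :
    A.IsSetPartition (HyperplaneArrangement.chainPartition X) ∧
      (A.IsNicePartition (HyperplaneArrangement.chainPartition X) ↔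
        ∀ i, HyperplaneArrangement.IsModular (X i)) := by
 
  exact ⟨hX.isSetPartition, hX.isModular_of_isNicePartition, fun hmod =>
    ⟨hX.isSetPartition, hX.isIndependentPartition, fun _ hY => hX.exists_ncard_eq_one hmod hY⟩⟩
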